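/- **Setting.** An instance of the bounded job start scheduling problem with $g=1$ consists of $m$ identical parallel machines and jobs $1,\dots,n$ with positive integer processing times $p_j$. A schedule assigns each job $j$ to a machine and to an integer start time $s_j\ge 0$; job $j$ then runs without interruption on its machine during $[s_j,s_j+p_j)$. It is feasible if jobs on the same machine do not overlap and at most one job starts in each unit slot $[t,t+1)$. Its makespan is $\max_j (s_j+p_j)$. **Algorithm LSM on $M$ machines.** Put $M^L=\lceil 5M/6\rceil$; job $j$ is long if $p_j\ge M^L$ and short otherwise. For $t=0,1,\dots,\sum_jp_j-1$: if fewer than $M$ jobs are running in slot $t$, then (a) if fewer than $M^L$ long jobs are running and some long job has not been started, start a longest unstarted long job at time $t$; (b) otherwise start a longest unstarted short job at time $t$, if there is one. If $M$ jobs are running, nothing is started. **Theorem.** (i) There are constants $0<\varepsilon\le 1/50$ and $m_0$ such that the following holds for every $m\ge m_0$. For every instance on $m$ machines in which at most $\lceil 5m/6\rceil$ jobs satisfy $$p_j>(1-\varepsilon)\max\Bigl\{\tfrac1m\sum_{j'}p_{j'},\ \max_{j'}\{j'+p_{j'}\}\Bigr\}$$ (in $\max_{j'}\{j'+p_{j'}\}$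 the jobs are numbered so that $p_1\ge\dots\ge p_n$), LSM on $m$ machines starts all jobs and produces a feasible schedule whose makespan is at most $1.985$ times the minimum makespan on $m$ machines. (ii) There is a constant $m_0$ such that for every $m\ge m_0$ and every instance, LSM on $m'=\lceil 6m/5\rceil$ machines (which reserves $\lceil 5m'/6\rceil$ of them for long jobs) starts all jobs and produces a feasible schedule on $m'$ machines whose makespan is at most $1.985$ times the minimum makespan on $m$ machines. -/

import Mathlib

/-! Bounded job start scheduling. Time is divided into unit slots `0, 1, 2, …`, slot `t` being the
interval `[t, t + 1)`. The jobs are `Fin n`, and job `j` has integer processing time `p j`. A job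
started at `s j` runs without interruption during `[s j, s j + p j)`. -/

namespace BJSP

/-- The start times `s` form a feasible schedule on `M` identical machines with at most `g` job
starts per slot: every job is assigned to a machine, jobs on the same machine do not overlap, and
at most `g` jobs begin in any slot. -/
def Feasible {n : ℕ} (M g : ℕ) (p s : Fin n → ℕ) : Prop :=
  (∃ machine : Fin n → Fin M, ∀ i j, i ≠ j → machine i = machine j →
    s i + p i ≤ s j ∨ s j + p j ≤ s i) ∧
  ∀ t, (Finset.univ.filter fun j => s j = t).card ≤ g

/-- The last completion time of a schedule. -/
def makespan {n : ℕ} (p s : Fin n → ℕ) : ℕ :=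
  Finset.univ.sup fun j => s j + p j

/-! ### Long-Short Mixing

A partial schedule is a map `σ : Fin n → Option ℕ`; `σ j = some u` says that `j` was started at
slot `u`, and `σ j = none` says that `j` has not been started yet. -/

/-- The jobs of the partial schedule that are running in slot `t`. -/
def alive {n : ℕ} (p : Fin n → ℕ) (σ : Fin n → Option ℕ) (t : ℕ) : Finset (Fin n) :=
  Finset.univ.filter fun j => ∃ u ∈ σ j, u ≤ t ∧ t < u + p j

/-- The jobs that have not been started. -/
def pending {n : ℕ} (σ : Fin n → Option ℕ) : Finset (Fin n) :=
  Finset.univ.filter fun j => σ j = none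

/-- A longest job of a nonempty set of jobs (the one of least index among the longest). -/
def longest {n : ℕ} (p : Fin n → ℕ) (R : Finset (Fin n)) (hR : R.Nonempty) : Fin n :=
  (R.filter fun j => ∀ i ∈ R, p i ≤ p j).min' (by
    obtain ⟨j, hj, hmax⟩ := R.exists_max_image p hR
    exact ⟨j, Finset.mem_filter.mpr ⟨hj, hmax⟩⟩)

/-- Start a longest job of `R` in slot `t`; do nothing if `R` is empty. -/
def startLongest {n : ℕ} (p : Fin n → ℕ) (t : ℕ) (R : Finset (Fin n)) (σ : Fin n → Option ℕ) :
    Fin n → Option ℕ :=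
  if hR : R.Nonempty then Function.update σ (longest p R hR) (some t) else σ

/-- What the algorithm does in slot `t`, on `M` machines of which `mL` are reserved for long jobs;
a job is long if its processing time is at least `mL`, and short otherwise. -/
def lsmStep {n : ℕ} (M mL : ℕ) (p : Fin n → ℕ) (t : ℕ) (σ : Fin n → Option ℕ) :
    Fin n → Option ℕ :=
  let pendingLong := (pending σ).filter fun j => mL ≤ p j
  let pendingShort := (pending σ).filter fun j => p j < mL
  let aliveLong := (alive p σ t).filter fun j => mL ≤ p j
  if (alive p σ t).card < M then
    if aliveLong.card < mL ∧ pendingLong.Nonempty then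
      startLongest p t pendingLong σ
    else
      startLongest p t pendingShort σ
  else σ

/-- The partial schedule after the first `k` slots. -/
def lsmRun {n : ℕ} (M mL : ℕ) (p : Fin n → ℕ) : ℕ → Fin n → Option ℕ
  | 0 => fun _ => none
  | k + 1 => lsmStep M mL p k (lsmRun M mL p k)

/-- The number `⌈5M/6⌉` of machines that Long-Short Mixing reserves for long jobs. -/
def reserved (M : ℕ) : ℕ := ⌈(5 * M / 6 : ℚ)⌉₊

/-- The output of Long-Short Mixing on `M` machines, with time horizon `∑ j, p j`. -/
def lsm {n : ℕ} (M : ℕ) (p : Fin n → ℕ) : Fin n → Option ℕ :=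
  lsmRun M (reserved M) p (∑ j, p j)

/-- On the instance `p` with `g = 1`, Long-Short Mixing run on `M` machines starts every job within
its time horizon, yields a feasible schedule on `M` machines, and its makespan is at most `ρ` times
the makespan of every feasible schedule on `m` machines. -/
def LSMApprox {n : ℕ} (ρ : ℝ) (m M : ℕ) (p : Fin n → ℕ) : Prop :=
  ∃ s : Fin n → ℕ, (∀ j, lsm M p j = some (s j)) ∧ Feasible M 1 p s ∧
    ∀ s' : Fin n → ℕ, Feasible m 1 p s' → (makespan p s : ℝ) ≤ ρ * makespan p s'

/-! ### Jobs of near-maximal length -/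

/-- The processing times in non-increasing order (the largest at index `0`). -/
def sortedDesc {n : ℕ} (p : Fin n → ℕ) (i : Fin n) : ℕ := p (Tuple.sort p i.rev)

/-- `max {(1/m) ∑ⱼ pⱼ, maxⱼ (j + pⱼ)}`, where in the second term the jobs are numbered `1, …, n`
in order of non-increasing processing time. -/
noncomputable def lengthBound {n : ℕ} (m : ℕ) (p : Fin n → ℕ) : ℝ :=
  max ((∑ j, (p j : ℝ)) / m)
    ((Finset.univ.sup fun i : Fin n => ((i : ℕ) + 1) + sortedDesc p i : ℕ) : ℝ)

/-- The jobs of near-maximal length, `pⱼ > (1 - ε) max {(1/m) ∑ⱼ pⱼ, maxⱼ (j + pⱼ)}`. -/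
noncomputable def nearMaximal {n : ℕ} (ε : ℝ) (m : ℕ) (p : Fin n → ℕ) : Finset (Fin n) :=
  Finset.univ.filter fun j => (1 - ε) * lengthBound m p < (p j : ℝ)

end BJSP

/-!
Let `D` be the makespan of an arbitrary feasible schedule on `m` machines, `M` the number of
machines of Long-Short Mixing and `mL` the number of those reserved for long jobs. Three lower
bounds on `D` are used: the total work is at most `m D`; if `k + 1` jobs have length at least `x`,
then `k + x ≤ D`, because their starts are distinct; and at most `m` jobs are longer than `D / 2`.
The algorithm enters only through the greedy rules `IsMixing`. Let `l` be a job and consider its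
completion time `s l + p l`.

If `l` is short, then every slot before `s l` either starts a job at least as long as `l` or is
full, that is, has `M` running jobs. The starts together with `p l` fit into `D`, so the completion
time is at most `D + F`, where `F` is the number of full slots. On `M ≥ 6m/5` machines `F ≤ 5D/6` by
the total work. On `M = m` machines one has to find work outside the full slots: since short jobs
are shorter than `mL`, filling the remaining `m - mL ≈ m/6` machines takes about `F/5` short starts,
and each of them happens in a slot that is not full but has at least `m/6` running jobs
(`IsMixing.exists_short_starts`). Hence `F (1 + 1/30) ≤ D`, up to rounding.

If `l` is long, only the long jobs matter: they are list scheduled on `mL` machines with one start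
per slot (`IsMixing.long_greedy`), and the machine time lost is at most `mL / 2` per start
(`two_mul_le_of_greedy`). With `K` the number of long jobs before `l`, this gives
`s l ≤ (m / mL) D + K / 2`, while `K + p l ≤ D`; so the completion time is at most
`1.2 D + D / 2 + p l / 2`, which is at most `1.95 D` when `p l ≤ D / 2`. When `p l > D / 2`, the
`K + 1` long jobs up to `l` are at most `m` many. If `K < mL` they start without delay and `l` ends
by `D`; this covers `mL ≥ m`. Otherwise `s l ≤ D + K - mL` (`IsMixing.start_add_le`), which is
enough if `mL` is not small compared with `D`, since `K + p l ≤ D`, and is enough for small `mL`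
too, since then `K - mL ≤ mL / 5` is negligible and `l` is not of near-maximal length.
-/

namespace BJSP

open Finset

variable {n : ℕ}

/-! ### Counting running jobs -/

/-- The jobs of `J` that were started before slot `t` and are still running in it. -/
def carried (J : Finset (Fin n)) (p s : Fin n → ℕ) (t : ℕ) : Finset (Fin n) :=
  J.filter fun j => s j < t ∧ t < s j + p j

/-- The jobs of `J` that occupy a machine in slot `t`, a job started in `t` included. -/
def busy (J : Finset (Fin n)) (p s : Fin n → ℕ) (t : ℕ) : Finset (Fin n) :=
  J.filter fun j => s j ≤ t ∧ t < s j + p j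

/-- The jobs of `J` that are started before slot `t`. -/
def startedBefore (J : Finset (Fin n)) (s : Fin n → ℕ) (t : ℕ) : Finset (Fin n) :=
  J.filter fun j => s j < t

/-- The jobs of length at least `mL`. -/
def longJobs (mL : ℕ) (p : Fin n → ℕ) : Finset (Fin n) := univ.filter fun j => mL ≤ p j

/-- The jobs of length less than `mL`. -/
def shortJobs (mL : ℕ) (p : Fin n → ℕ) : Finset (Fin n) := univ.filter fun j => p j < mL

lemma carried_subset_busy (J : Finset (Fin n)) (p s : Fin n → ℕ) (t : ℕ) :
    carried J p s t ⊆ busy J p s t := by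
  intro j
  simp only [carried, busy, mem_filter]
  exact fun h => ⟨h.1, h.2.1.le, h.2.2⟩

lemma busy_mono {J J' : Finset (Fin n)} (h : J ⊆ J') (p s : Fin n → ℕ) (t : ℕ) :
    busy J p s t ⊆ busy J' p s t := filter_subset_filter _ h

lemma card_carried_univ (mL : ℕ) (p s : Fin n → ℕ) (t : ℕ) :
    (carried univ p s t).card =
      (carried (longJobs mL p) p s t).card + (carried (shortJobs mL p) p s t).card := by
  rw [← card_union_of_disjoint]
  · congr 1
    ext j
    simp only [carried, longJobs, shortJobs, mem_filter, mem_union, mem_univ, true_and]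
    omega
  · rw [disjoint_left]
    intro j
    simp only [carried, longJobs, shortJobs, mem_filter, mem_univ, true_and]
    omega

lemma sum_card_busy_le (J : Finset (Fin n)) (p s : Fin n → ℕ) (I : Finset ℕ) :
    ∑ t ∈ I, (busy J p s t).card ≤ ∑ j ∈ J, p j := by
  have h := sum_card_bipartiteAbove_eq_sum_card_bipartiteBelow (s := I) (t := J)
    (fun t j => s j ≤ t ∧ t < s j + p j)
  change ∑ t ∈ I, (busy J p s t).card = _ at h
  rw [h]
  refine sum_le_sum fun j _ => ?_
  calc _ ≤ (Ico (s j) (s j + p j)).card := by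
        refine card_le_card fun t ht => ?_
        simpa using (mem_filter.mp ht).2
    _ = p j := by simp

lemma card_startedBefore_le {s : Fin n → ℕ} (hs : Function.Injective s) (J : Finset (Fin n))
    (t : ℕ) : (startedBefore J s t).card ≤ t := by
  calc _ ≤ (range t).card := by
        refine card_le_card_of_injOn s (fun j hj => ?_) hs.injOn
        simpa using (mem_filter.mp hj).2
    _ = t := card_range t

/-- If a job of `J` starts in every slot of `[a, b)`, at least `b - a` jobs of `J` start there. -/
lemma sub_le_card_starts {s : Fin n → ℕ} {J : Finset (Fin n)} {a b : ℕ}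
    (h : ∀ t, a ≤ t → t < b → ∃ j ∈ J, s j = t) :
    b - a ≤ (J.filter fun j => a ≤ s j ∧ s j < b).card := by
  calc b - a = (Ico a b).card := by simp
    _ ≤ ((J.filter fun j => a ≤ s j ∧ s j < b).image s).card := by
        refine card_le_card fun t ht => ?_
        obtain ⟨ha, hb⟩ := mem_Ico.mp ht
        obtain ⟨j, hj, rfl⟩ := h t ha hb
        exact mem_image_of_mem _ (mem_filter.mpr ⟨hj, ha, hb⟩)
    _ ≤ _ := card_image_le

/-- The jobs started before `b`, split at `a`. -/
lemma card_startedBefore_split {s : Fin n → ℕ} (J : Finset (Fin n)) {a b : ℕ} (hab : a ≤ b) :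
    (startedBefore J s b).card =
      (startedBefore J s a).card + (J.filter fun j => a ≤ s j ∧ s j < b).card := by
  rw [← card_union_of_disjoint]
  · congr 1
    ext j
    simp only [startedBefore, mem_filter, mem_union, ← and_or_left]
    refine and_congr_right fun _ => ?_
    omega
  · rw [disjoint_left]
    intro j
    simp only [startedBefore, mem_filter]
    omega

/-- A cap on the number of running jobs that is respected at every start is respected always:
look at the most recent start among the jobs running in slot `t`. -/
lemma card_carried_le {p s : Fin n → ℕ} (hs : Function.Injective s) {J : Finset (Fin n)} {c : ℕ}
    {t : ℕ} (h : ∀ j ∈ J, s j < t → (carried J p s (s j)).card < c) :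
    (carried J p s t).card ≤ c := by
  rcases (carried J p s t).eq_empty_or_nonempty with h0 | h0
  · simp [h0]
  obtain ⟨j, hj, hmax⟩ := exists_max_image _ s h0
  have hj' := mem_filter.mp hj
  have hsub : carried J p s t ⊆ insert j (carried J p s (s j)) := by
    intro i hi
    rw [mem_insert]
    by_cases hij : i = j
    · exact Or.inl hij
    have hi' := mem_filter.mp hi
    have h1 := hmax i hi
    have h2 : s i ≠ s j := fun e => hij (hs e)
    exact Or.inr (mem_filter.mpr ⟨hi'.1, by omega, by omega⟩)
  have h1 := card_le_card hsub
  have h2 := card_insert_le j (carried J p s (s j))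
  have h3 := h j hj'.1 hj'.2.1
  omega

/-! ### Lower bounds on the makespan of a feasible schedule -/

lemma add_le_makespan (p s : Fin n → ℕ) (j : Fin n) : s j + p j ≤ makespan p s :=
  le_sup (f := fun j => s j + p j) (mem_univ j)

lemma Feasible.injective {M : ℕ} {p s : Fin n → ℕ} (h : Feasible M 1 p s) :
    Function.Injective s := by
  intro i j hij
  exact card_le_one.mp (h.2 (s j)) i (by simp [hij]) j (by simp)

lemma Feasible.sum_le {M g : ℕ} {p s : Fin n → ℕ} (h : Feasible M g p s) :
    ∑ j, p j ≤ M * makespan p s := by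
  obtain ⟨μ, hμ⟩ := h.1
  have hm : ∀ c : Fin M, ∑ j ∈ univ.filter (fun j => μ j = c), p j ≤ makespan p s := by
    intro c
    calc ∑ j ∈ univ.filter (fun j => μ j = c), p j
        = ∑ j ∈ univ.filter (fun j => μ j = c), (Ico (s j) (s j + p j)).card := by simp
      _ = ((univ.filter (fun j => μ j = c)).biUnion fun j => Ico (s j) (s j + p j)).card := by
          rw [card_biUnion]
          intro i hi j hj hij
          have hi' : μ i = c := by simpa using hi
          have hj' : μ j = c := by simpa using hj
          have := hμ i j hij (hi'.trans hj'.symm)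
          change Disjoint (Ico (s i) (s i + p i)) (Ico (s j) (s j + p j))
          rw [disjoint_left]
          intro t
          simp only [mem_Ico]
          omega
      _ ≤ (range (makespan p s)).card := by
          refine card_le_card fun t ht => ?_
          obtain ⟨j, -, hj⟩ := mem_biUnion.mp ht
          have := add_le_makespan p s j
          rw [mem_Ico] at hj
          rw [mem_range]
          omega
      _ = makespan p s := card_range _
  calc ∑ j, p j = ∑ c : Fin M, ∑ j ∈ univ.filter (fun j => μ j = c), p j :=
        (sum_fiberwise univ μ p).symm
    _ ≤ ∑ _c : Fin M, makespan p s := sum_le_sum fun c _ => hm c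
    _ = M * makespan p s := by simp

/-- `k + 1` jobs of length at least `x` need time `k + x`: the last of them starts at `k` or
later. -/
lemma Feasible.card_add_le {M : ℕ} {p s : Fin n → ℕ} (h : Feasible M 1 p s)
    {S : Finset (Fin n)} {k x : ℕ} (hk : k + 1 ≤ S.card) (hx : ∀ j ∈ S, x ≤ p j) :
    k + x ≤ makespan p s := by
  obtain ⟨j, hj, hkj⟩ : ∃ j ∈ S, k ≤ s j := by
    by_contra! hlt
    have h1 : S ⊆ startedBefore S s k := fun j hj => mem_filter.mpr ⟨hj, hlt j hj⟩
    have h2 := card_le_card h1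
    have h3 := card_startedBefore_le h.injective S k
    omega
  have h1 := add_le_makespan p s j
  have h2 := hx j hj
  omega

/-- No machine runs two jobs that are longer than half the makespan. -/
lemma Feasible.card_le_of_half {M g : ℕ} {p s : Fin n → ℕ} (h : Feasible M g p s)
    {S : Finset (Fin n)} (hS : ∀ j ∈ S, makespan p s < 2 * p j) : S.card ≤ M := by
  obtain ⟨μ, hμ⟩ := h.1
  calc S.card ≤ (univ : Finset (Fin M)).card := by
        refine card_le_card_of_injOn μ (fun _ _ => mem_univ _) ?_
        intro i hi j hj hij
        by_contra hne
        have h1 := hμ i j hne hij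
        have h2 := add_le_makespan p s i
        have h3 := add_le_makespan p s j
        have h4 := hS i hi
        have h5 := hS j hj
        omega
    _ = M := by simp

/-- Slots are numbered from `0`, whereas `lengthBound` numbers the jobs from `1`; hence the `1`. -/
lemma Feasible.lengthBound_le {m : ℕ} (hm : 0 < m) {p s : Fin n → ℕ} (h : Feasible m 1 p s) :
    lengthBound m p ≤ makespan p s + 1 := by
  have hm' : (0 : ℝ) < m := by exact_mod_cast hm
  refine max_le ?_ ?_
  · rw [div_le_iff₀ hm']
    have h1 : ((∑ j, p j : ℕ) : ℝ) ≤ ((m * makespan p s : ℕ) : ℝ) := by exact_mod_cast h.sum_le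
    push_cast at h1
    nlinarith
  · have : (univ.sup fun i : Fin n => ((i : ℕ) + 1) + sortedDesc p i) ≤ makespan p s + 1 := by
      refine Finset.sup_le fun i _ => ?_
      have hcard : (i : ℕ) + 1 ≤ ((Iic i).image fun k => Tuple.sort p k.rev).card := by
        rw [card_image_of_injective]
        · simp
        · exact (Tuple.sort p).injective.comp Fin.rev_injective
      have := h.card_add_le (x := sortedDesc p i) hcard (by
        intro j hj
        obtain ⟨k, hk, rfl⟩ := mem_image.mp hj
        exact Tuple.monotone_sort p (Fin.rev_le_rev.mpr (mem_Iic.mp hk)))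
      omega
    exact_mod_cast this

/-! ### The greedy rules obeyed by Long-Short Mixing -/

/-- The rules by which Long-Short Mixing picks the start times `s`, stated about the finished
schedule: an unstarted job in slot `t` is one with `t ≤ s j`. -/
structure IsMixing (M mL : ℕ) (p s : Fin n → ℕ) : Prop where
  inj : Function.Injective s
  /-- A job starts only if a machine is free. -/
  free : ∀ j, (carried univ p s (s j)).card < M
  /-- A long job starts only if fewer than `mL` long jobs are running. -/
  free_long : ∀ j ∈ longJobs mL p, (carried (longJobs mL p) p s (s j)).card < mL
  long_order : ∀ i ∈ longJobs mL p, ∀ j ∈ longJobs mL p, s j < s i → p i ≤ p j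
  short_order : ∀ i ∈ shortJobs mL p, ∀ j ∈ shortJobs mL p, s j < s i → p i ≤ p j
  /-- A short job overtakes a long one only if `mL` long jobs are running. -/
  overtake : ∀ i ∈ longJobs mL p, ∀ j ∈ shortJobs mL p, s j < s i →
    mL ≤ (carried (longJobs mL p) p s (s j)).card
  /-- If nothing starts in slot `t` although `i` is waiting, then all machines are taken, or `i` is
  long and `mL` long jobs are running. -/
  idle : ∀ i t, t < s i → (∀ j, s j ≠ t) → M ≤ (carried univ p s t).card ∨
    (mL ≤ p i ∧ mL ≤ (carried (longJobs mL p) p s t).card)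

lemma startLongest_cases (p : Fin n → ℕ) (t : ℕ) (R : Finset (Fin n)) (σ : Fin n → Option ℕ) :
    (∃ j ∈ R, (∀ i ∈ R, p i ≤ p j) ∧ startLongest p t R σ = Function.update σ j (some t)) ∨
      (R = ∅ ∧ startLongest p t R σ = σ) := by
  by_cases hR : R.Nonempty
  · left
    have h : longest p R hR ∈ R.filter fun j => ∀ i ∈ R, p i ≤ p j := min'_mem _ _
    obtain ⟨h1, h2⟩ := mem_filter.mp h
    exact ⟨_, h1, h2, by simp [startLongest, hR]⟩
  · right
    exact ⟨not_nonempty_iff_eq_empty.mp hR, by simp [startLongest, hR]⟩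

/-- One slot of the algorithm: either a job `j` starts, or nothing changes. -/
lemma lsmStep_cases (M mL : ℕ) (p : Fin n → ℕ) (t : ℕ) (σ : Fin n → Option ℕ) :
    (∃ j, σ j = none ∧ lsmStep M mL p t σ = Function.update σ j (some t) ∧
      (alive p σ t).card < M ∧
      (mL ≤ p j → ((alive p σ t).filter fun i => mL ≤ p i).card < mL ∧
        ∀ i, σ i = none → mL ≤ p i → p i ≤ p j) ∧
      (p j < mL → (∀ i, σ i = none → mL ≤ p i →
          mL ≤ ((alive p σ t).filter fun i => mL ≤ p i).card) ∧
        ∀ i, σ i = none → p i < mL → p i ≤ p j)) ∨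
    (lsmStep M mL p t σ = σ ∧ (M ≤ (alive p σ t).card ∨
      ∀ i, σ i = none → mL ≤ p i ∧ mL ≤ ((alive p σ t).filter fun i => mL ≤ p i).card)) := by
  unfold lsmStep
  by_cases hM : (alive p σ t).card < M
  swap
  · right
    simp only [hM, if_false]
    exact ⟨trivial, Or.inl (by omega)⟩
  simp only [hM, if_true]
  split_ifs with hL
  · rcases startLongest_cases p t ((pending σ).filter fun j => mL ≤ p j) σ with
      ⟨j, hj, hmax, he⟩ | ⟨h0, -⟩
    · left
      simp only [pending, mem_filter, mem_univ, true_and] at hj hmax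
      exact ⟨j, hj.1, he, trivial, fun _ => ⟨hL.1, fun i h1 h2 => hmax i ⟨h1, h2⟩⟩,
        fun h => by omega⟩
    · exact absurd hL.2 (by simp [h0])
  · have hwait : ∀ i, σ i = none → mL ≤ p i →
        mL ≤ ((alive p σ t).filter fun i => mL ≤ p i).card := by
      intro i h1 h2
      by_contra h3
      exact hL ⟨by omega, i, by simp [pending, h1, h2]⟩
    rcases startLongest_cases p t ((pending σ).filter fun j => p j < mL) σ with
      ⟨j, hj, hmax, he⟩ | ⟨h0, he⟩
    · left
      simp only [pending, mem_filter, mem_univ, true_and] at hj hmax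
      exact ⟨j, hj.1, he, trivial, fun h => by omega,
        fun _ => ⟨hwait, fun i h1 h2 => hmax i ⟨h1, h2⟩⟩⟩
    · right
      refine ⟨he, Or.inr fun i hi => ?_⟩
      have h1 : mL ≤ p i := by
        by_contra h1
        have : i ∈ (pending σ).filter fun j => p j < mL := by
          simp only [pending, mem_filter, mem_univ, true_and]
          exact ⟨hi, by omega⟩
        simp [h0] at this
      exact ⟨h1, hwait i hi h1⟩

lemma lsmRun_lt {M mL : ℕ} {p : Fin n → ℕ} {t u : ℕ} {j : Fin n}
    (h : lsmRun M mL p t j = some u) : u < t := by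
  induction t with
  | zero => simp [lsmRun] at h
  | succ t ih =>
    rw [lsmRun] at h
    rcases lsmStep_cases M mL p t (lsmRun M mL p t) with ⟨i, -, he, -⟩ | ⟨he, -⟩
    · rw [he, Function.update_apply] at h
      split_ifs at h
      · simp at h; omega
      · have := ih h; omega
    · rw [he] at h
      have := ih h; omega

lemma lsmRun_mono {M mL : ℕ} {p : Fin n → ℕ} {t t' u : ℕ} {j : Fin n} (htt : t ≤ t')
    (h : lsmRun M mL p t j = some u) : lsmRun M mL p t' j = some u := by
  induction t', htt using Nat.le_induction with
  | base => exact h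
  | succ k _ ih =>
    rw [lsmRun]
    rcases lsmStep_cases M mL p k (lsmRun M mL p k) with ⟨i, hi, he, -⟩ | ⟨he, -⟩
    · rw [he, Function.update_apply, if_neg]
      · exact ih
      · rintro rfl
        simp [hi] at ih
    · rw [he]; exact ih

lemma lsmRun_succ_of_some {M mL : ℕ} {p : Fin n → ℕ} {t u : ℕ} {j : Fin n}
    (h : lsmRun M mL p t j = some u) : lsmRun M mL p (u + 1) j = some u := by
  induction t with
  | zero => simp [lsmRun] at h
  | succ t ih =>
    by_cases h0 : lsmRun M mL p t j = none
    · have h1 := h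
      rw [lsmRun] at h1
      rcases lsmStep_cases M mL p t (lsmRun M mL p t) with ⟨i, -, he, -⟩ | ⟨he, -⟩
      · rw [he, Function.update_apply] at h1
        split_ifs at h1
        · simp only [Option.some.injEq] at h1
          subst h1; exact h
        · simp [h0] at h1
      · rw [he, h0] at h1; simp at h1
    · obtain ⟨v, hv⟩ := Option.ne_none_iff_exists'.mp h0
      have := lsmRun_mono (Nat.le_succ t) hv
      rw [h] at this
      simp only [Option.some.injEq] at this
      exact ih (this ▸ hv)

/-- The partial schedule at slot `t` is the final one, cut off at `t`. -/
lemma lsmRun_eq_some_iff {M mL : ℕ} {p s : Fin n → ℕ} {T : ℕ}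
    (hs : ∀ j, lsmRun M mL p T j = some (s j)) {t : ℕ} (ht : t ≤ T) (j : Fin n) (u : ℕ) :
    lsmRun M mL p t j = some u ↔ s j = u ∧ s j < t := by
  constructor
  · intro h
    have h1 := lsmRun_mono ht h
    rw [hs j, Option.some.injEq] at h1
    exact ⟨h1, h1 ▸ lsmRun_lt h⟩
  · rintro ⟨rfl, h⟩
    exact lsmRun_mono h (lsmRun_succ_of_some (hs j))

lemma lsmRun_eq_none_iff {M mL : ℕ} {p s : Fin n → ℕ} {T : ℕ}
    (hs : ∀ j, lsmRun M mL p T j = some (s j)) {t : ℕ} (ht : t ≤ T) (j : Fin n) :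
    lsmRun M mL p t j = none ↔ t ≤ s j := by
  rw [Option.eq_none_iff_forall_ne_some]
  simp only [ne_eq, lsmRun_eq_some_iff hs ht]
  constructor
  · intro h
    have := h (s j)
    omega
  · intro h u; omega

/-- While a job is waiting, every slot is used by some other job; so the horizon `∑ j, p j` is long
enough to start them all. -/
lemma lsmRun_complete {M mL : ℕ} {p : Fin n → ℕ} (hM : 0 < M) (hmL : 0 < mL)
    (hp : ∀ j, 0 < p j) (j : Fin n) : lsmRun M mL p (∑ i, p i) j ≠ none := by
  intro hj
  set T := ∑ i, p i with hT
  have hcover : ∀ t < T, ∃ i, i ≠ j ∧ ∃ u, lsmRun M mL p T i = some u ∧ u ≤ t ∧ t < u + p i := by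
    intro t ht
    have hjt : lsmRun M mL p t j = none := by
      by_contra h
      obtain ⟨v, hv⟩ := Option.ne_none_iff_exists'.mp h
      have := lsmRun_mono ht.le hv
      simp [hj] at this
    suffices ∃ i u, lsmRun M mL p T i = some u ∧ u ≤ t ∧ t < u + p i by
      obtain ⟨i, u, h1, h2⟩ := this
      refine ⟨i, ?_, u, h1, h2⟩
      rintro rfl
      simp [hj] at h1
    have halive : (alive p (lsmRun M mL p t) t).Nonempty →
        ∃ i u, lsmRun M mL p T i = some u ∧ u ≤ t ∧ t < u + p i := by
      rintro ⟨i, hi⟩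
      obtain ⟨-, u, hu, h2⟩ := mem_filter.mp hi
      exact ⟨i, u, lsmRun_mono ht.le hu, h2⟩
    rcases lsmStep_cases M mL p t (lsmRun M mL p t) with ⟨i, -, he, -⟩ | ⟨-, hfull | hwait⟩
    · refine ⟨i, t, lsmRun_mono ht (t := t + 1) ?_, le_rfl, by have := hp i; omega⟩
      rw [lsmRun, he, Function.update_self]
    · exact halive (card_pos.mp (by omega))
    · refine halive ((card_pos.mp ?_).mono (filter_subset (fun i => mL ≤ p i) _))
      have := (hwait j hjt).2
      omega
  have h1 : range T ⊆ (univ.erase j).biUnion fun i =>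
      Ico ((lsmRun M mL p T i).getD 0) ((lsmRun M mL p T i).getD 0 + p i) := by
    intro t ht
    obtain ⟨i, hij, u, hu, h2⟩ := hcover t (mem_range.mp ht)
    rw [mem_biUnion]
    exact ⟨i, by simp [hij], by simp [hu, h2]⟩
  have h2 := (card_le_card h1).trans card_biUnion_le
  simp only [card_range, Nat.card_Ico, Nat.add_sub_cancel_left] at h2
  have h3 := sum_erase_add univ p (mem_univ j)
  have := hp j
  omega

lemma isMixing_of_lsmRun {M mL : ℕ} {p s : Fin n → ℕ} {T : ℕ}
    (hs : ∀ j, lsmRun M mL p T j = some (s j)) : IsMixing M mL p s := by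
  have hlt : ∀ j, s j < T := fun j => lsmRun_lt (hs j)
  have hsome := fun {t} ht j u => lsmRun_eq_some_iff hs (t := t) ht j u
  have hnone := fun {t} ht j => lsmRun_eq_none_iff hs (t := t) ht j
  have halive : ∀ t ≤ T, alive p (lsmRun M mL p t) t = carried univ p s t := by
    intro t ht
    ext j
    simp only [alive, carried, mem_filter, mem_univ, true_and, Option.mem_def, hsome ht]
    constructor
    · rintro ⟨u, ⟨rfl, h1⟩, h2⟩; omega
    · intro h; exact ⟨s j, ⟨rfl, h.1⟩, by omega⟩
  have haliveL : ∀ t ≤ T, ((alive p (lsmRun M mL p t) t).filter fun i => mL ≤ p i) =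
      carried (longJobs mL p) p s t := by
    intro t ht
    rw [halive t ht]
    ext j
    simp only [carried, longJobs, mem_filter, mem_univ, true_and]
    tauto
  -- The job that changes state in slot `s j` is `j` itself.
  have key : ∀ j, (∀ i, s i = s j → i = j) ∧ (carried univ p s (s j)).card < M ∧
      (mL ≤ p j → (carried (longJobs mL p) p s (s j)).card < mL ∧
        ∀ i, s j ≤ s i → mL ≤ p i → p i ≤ p j) ∧
      (p j < mL → (∀ i, s j ≤ s i → mL ≤ p i → mL ≤ (carried (longJobs mL p) p s (s j)).card) ∧
        ∀ i, s j ≤ s i → p i < mL → p i ≤ p j) := by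
    intro j
    have hT := (hlt j).le
    have hnew : ∀ i, s i = s j → lsmStep M mL p (s j) (lsmRun M mL p (s j)) i = some (s j) := by
      intro i hi
      have := (hsome (hlt j) i (s j)).mpr ⟨hi, by omega⟩
      rwa [lsmRun] at this
    have hold : ∀ i, s i = s j → lsmRun M mL p (s j) i = none := fun i hi =>
      (hnone hT i).mpr hi.ge
    rcases lsmStep_cases M mL p (s j) (lsmRun M mL p (s j)) with ⟨k, -, he, h⟩ | ⟨he, -⟩
    · have hk : ∀ i, s i = s j → i = k := by
        intro i hi
        by_contra hne
        have := hnew i hi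
        rw [he, Function.update_of_ne hne, hold i hi] at this
        simp at this
      obtain rfl := hk j rfl
      simp only [haliveL _ hT, hnone hT] at h
      rw [halive _ hT] at h
      exact ⟨hk, h⟩
    · have := hnew j rfl
      rw [he, hold j rfl] at this
      simp at this
  refine ⟨fun i j hij => (key j).1 i hij, fun j => (key j).2.1, ?_, ?_, ?_, ?_, ?_⟩
  · intro j hj
    exact ((key j).2.2.1 (mem_filter.mp hj).2).1
  · intro i hi j hj h
    exact ((key j).2.2.1 (mem_filter.mp hj).2).2 i h.le (mem_filter.mp hi).2
  · intro i hi j hj h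
    exact ((key j).2.2.2 (mem_filter.mp hj).2).2 i h.le (mem_filter.mp hi).2
  · intro i hi j hj h
    exact ((key j).2.2.2 (mem_filter.mp hj).2).1 i h.le (mem_filter.mp hi).2
  · intro i t hti hno
    have htT : t < T := hti.trans (hlt i)
    rcases lsmStep_cases M mL p t (lsmRun M mL p t) with ⟨k, hk, he, -⟩ | ⟨-, h⟩
    · have : lsmRun M mL p (t + 1) k = some t := by rw [lsmRun, he, Function.update_self]
      exact absurd ((hsome htT k t).mp this).1 (hno k)
    · simp only [haliveL _ htT.le, hnone htT.le] at h
      rw [halive _ htT.le] at h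
      exact h.imp id fun h => h i hti.le

/-- Machines can be assigned in the order of the start times, since one is free at every start. -/
lemma IsMixing.feasible {M mL : ℕ} {p s : Fin n → ℕ} (h : IsMixing M mL p s) (hM : 0 < M) :
    Feasible M 1 p s := by
  refine ⟨?_, fun t => card_le_one.mpr fun i hi j hj => h.inj ?_⟩
  swap
  · rw [(mem_filter.mp hi).2, (mem_filter.mp hj).2]
  -- A machine assignment for the jobs started before `N`.
  have key : ∀ N, ∃ μ : Fin n → Fin M, ∀ i j, s i < s j → s j < N → μ i = μ j →
      s i + p i ≤ s j := by
    intro N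
    induction N with
    | zero => exact ⟨fun _ => ⟨0, hM⟩, by simp⟩
    | succ N ih =>
      obtain ⟨μ, hμ⟩ := ih
      by_cases hN : ∃ k, s k = N
      · obtain ⟨k, rfl⟩ := hN
        have hlt : ((carried univ p s (s k)).image μ).card < (univ : Finset (Fin M)).card := by
          rw [card_univ, Fintype.card_fin]
          exact card_image_le.trans_lt (h.free k)
        obtain ⟨c, -, hc⟩ := exists_mem_notMem_of_card_lt_card hlt
        refine ⟨Function.update μ k c, fun i j hij hj he => ?_⟩
        have hik : i ≠ k := by rintro rfl; omega
        rw [Function.update_of_ne hik] at he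
        by_cases hjk : j = k
        · subst hjk
          rw [Function.update_self] at he
          by_contra hlt
          exact hc (mem_image.mpr ⟨i, mem_filter.mpr ⟨mem_univ _, hij, by omega⟩, he⟩)
        · rw [Function.update_of_ne hjk] at he
          have : s j ≠ s k := fun e => hjk (h.inj e)
          exact hμ i j hij (by omega) he
      · push Not at hN
        refine ⟨μ, fun i j hij hj he => hμ i j hij ?_ he⟩
        have := hN j
        omega
  obtain ⟨μ, hμ⟩ := key (makespan p s + 1)
  refine ⟨μ, fun i j hij he => ?_⟩
  have hi := add_le_makespan p s i
  have hj := add_le_makespan p s j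
  rcases lt_or_gt_of_ne (fun e => hij (h.inj e) : s i ≠ s j) with hlt | hlt
  · exact Or.inl (hμ i j hlt (by omega) he)
  · exact Or.inr (hμ j i hlt (by omega) he.symm)

/-! ### When the last job is short -/

lemma IsMixing.card_carried_long_le {M mL : ℕ} {p s : Fin n → ℕ} (h : IsMixing M mL p s) (t : ℕ) :
    (carried (longJobs mL p) p s t).card ≤ mL :=
  card_carried_le h.inj fun j hj _ => h.free_long j hj

/-- The slots before `N` in which no machine is free. -/
def fullSlots (M : ℕ) (p s : Fin n → ℕ) (N : ℕ) : Finset ℕ :=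
  (range N).filter fun t => M ≤ (carried univ p s t).card

lemma card_fullSlots_mul_le (M : ℕ) (p s : Fin n → ℕ) (N : ℕ) :
    (fullSlots M p s N).card * M ≤ ∑ j, p j := by
  refine le_trans ?_ (sum_card_busy_le univ p s (fullSlots M p s N))
  rw [← smul_eq_mul]
  exact card_nsmul_le_sum _ _ _ fun t ht =>
    (mem_filter.mp ht).2.trans (card_le_card (carried_subset_busy _ _ _ _))

/-- Before a short job `l` starts, each slot that is not full starts a job at least as long as
`l`, and any schedule spends a slot on each of these starts. -/
lemma IsMixing.short_completion_le {m M mL : ℕ} {p s s' : Fin n → ℕ} (h : IsMixing M mL p s)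
    (h' : Feasible m 1 p s') {l : Fin n} (hl : l ∈ shortJobs mL p) :
    s l + p l ≤ makespan p s' + (fullSlots M p s (s l)).card := by
  have hl' : p l < mL := (mem_filter.mp hl).2
  have hcover : range (s l) ⊆ fullSlots M p s (s l) ∪ (startedBefore univ s (s l)).image s := by
    intro t ht
    rw [mem_range] at ht
    rw [mem_union]
    by_cases hst : ∃ j, s j = t
    · obtain ⟨j, rfl⟩ := hst
      exact Or.inr (mem_image_of_mem _ (mem_filter.mpr ⟨mem_univ _, ht⟩))
    · push Not at hst
      rcases h.idle l t ht hst with hf | hf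
      · exact Or.inl (mem_filter.mpr ⟨mem_range.mpr ht, hf⟩)
      · omega
  have h1 := (card_le_card hcover).trans (card_union_le _ _)
  rw [card_range, card_image_of_injective _ h.inj] at h1
  have hnot : l ∉ startedBefore univ s (s l) := by simp [startedBefore]
  have h2 := h'.card_add_le (S := insert l (startedBefore univ s (s l))) (x := p l)
    (card_insert_of_notMem hnot).ge (by
      intro j hj
      rcases mem_insert.mp hj with rfl | hj
      · exact le_rfl
      · have hlt : s j < s l := (mem_filter.mp hj).2
        by_cases hjl : mL ≤ p j
        · omega
        · exact h.short_order l hl j (mem_filter.mpr ⟨mem_univ _, by omega⟩) hlt)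
  omega

/-- The work done outside the full slots. In a full slot at least `M - mL` short jobs are running,
each for less than `mL` slots, so the number `A` of short jobs started before the last full slot is
not small; and these jobs start in slots in which at least `M - mL` jobs are running, none of them
full. -/
lemma IsMixing.exists_short_starts {M mL : ℕ} {p s : Fin n → ℕ} (h : IsMixing M mL p s)
    (hM : M ≤ 2 * mL) (N : ℕ) :
    ∃ A : ℕ, (fullSlots M p s N).card * (M - mL) ≤ A * mL ∧
      (fullSlots M p s N).card * M + A * (M - mL) ≤ ∑ j, p j := by
  rcases (fullSlots M p s N).eq_empty_or_nonempty with h0 | h0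
  · exact ⟨0, by simp [h0]⟩
  obtain ⟨f, hf, hmax⟩ := exists_max_image _ id h0
  have hfull : ∀ t ∈ fullSlots M p s N, M ≤ (carried univ p s t).card := fun t ht =>
    (mem_filter.mp ht).2
  set A := startedBefore (shortJobs mL p) s f with hA
  refine ⟨A.card, ?_, ?_⟩
  · calc (fullSlots M p s N).card * (M - mL)
        ≤ ∑ t ∈ fullSlots M p s N, (busy A p s t).card := by
          rw [← smul_eq_mul]
          refine card_nsmul_le_sum _ _ _ fun t ht => ?_
          have h1 := hfull t ht
          rw [card_carried_univ mL] at h1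
          have h2 := h.card_carried_long_le t
          have h3 : carried (shortJobs mL p) p s t ⊆ busy A p s t := by
            intro j hj
            obtain ⟨h4, h5, h6⟩ := mem_filter.mp hj
            have h7 : t ≤ f := hmax t ht
            exact mem_filter.mpr ⟨mem_filter.mpr ⟨h4, by omega⟩, by omega, h6⟩
          have := card_le_card h3
          omega
      _ ≤ ∑ j ∈ A, p j := sum_card_busy_le _ _ _ _
      _ ≤ A.card * mL := by
          rw [← smul_eq_mul]
          refine sum_le_card_nsmul _ _ _ fun j hj => ?_
          exact (mem_filter.mp (mem_filter.mp hj).1).2.le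
  · have hload : ∀ j ∈ A, M - mL ≤ (busy univ p s (s j)).card := by
      intro j hj
      obtain ⟨hjS, hjf⟩ := mem_filter.mp hj
      by_cases hw : ∃ i ∈ longJobs mL p, s j < s i
      · obtain ⟨i, hi, hij⟩ := hw
        have h1 := h.overtake i hi j hjS hij
        have h2 := card_le_card ((carried_subset_busy (longJobs mL p) p s (s j)).trans
          (busy_mono (subset_univ _) p s (s j)))
        omega
      · -- All long jobs have started by now; those running in slot `f` are running here.
        push Not at hw
        have h1 := hfull f hf
        rw [card_carried_univ mL] at h1
        have h2 : (carried (shortJobs mL p) p s f).card ≤ mL := by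
          calc _ ≤ (Ico (f - mL) f).card := by
                refine card_le_card_of_injOn s (fun i hi => ?_) h.inj.injOn
                obtain ⟨h4, h5, h6⟩ := mem_filter.mp hi
                have h7 := (mem_filter.mp h4).2
                rw [mem_coe, mem_Ico]
                omega
            _ ≤ mL := by rw [Nat.card_Ico]; omega
        have h3 : carried (longJobs mL p) p s f ⊆ busy univ p s (s j) := by
          intro i hi
          obtain ⟨h4, h5, h6⟩ := mem_filter.mp hi
          exact mem_filter.mpr ⟨mem_univ _, hw i h4, by omega⟩
        have := card_le_card h3
        omega
    have hdisj : Disjoint (fullSlots M p s N) (A.image s) := by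
      rw [disjoint_left]
      intro t ht ht'
      obtain ⟨j, -, rfl⟩ := mem_image.mp ht'
      have := hfull _ ht
      have := h.free j
      omega
    refine le_trans ?_ (sum_card_busy_le univ p s (fullSlots M p s N ∪ A.image s))
    rw [sum_union hdisj, sum_image h.inj.injOn]
    refine add_le_add ?_ ?_
    · rw [← smul_eq_mul]
      exact card_nsmul_le_sum _ _ _ fun t ht =>
        (hfull t ht).trans (card_le_card (carried_subset_busy _ _ _ _))
    · rw [← smul_eq_mul]
      exact card_nsmul_le_sum _ _ _ hload

/-! ### When the last job is long -/

/-- While a long job waits, a long job starts or `mL` long jobs are running. For, as long as a long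
job waits, short jobs start only next to `mL` running long ones, so they never take more than
`M - mL` machines. -/
lemma IsMixing.long_greedy {M mL : ℕ} {p s : Fin n → ℕ} (h : IsMixing M mL p s) (hmL : mL ≤ M)
    {l : Fin n} (hl : l ∈ longJobs mL p) {t : ℕ} (ht : t < s l) :
    (∃ j ∈ longJobs mL p, s j = t) ∨ mL ≤ (carried (longJobs mL p) p s t).card := by
  by_cases hst : ∃ j, s j = t
  · obtain ⟨j, rfl⟩ := hst
    by_cases hj : mL ≤ p j
    · exact Or.inl ⟨j, mem_filter.mpr ⟨mem_univ _, hj⟩, rfl⟩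
    · exact Or.inr (h.overtake l hl j (mem_filter.mpr ⟨mem_univ _, by omega⟩) ht)
  · push Not at hst
    rcases h.idle l t ht hst with hf | hf
    · right
      have h1 : (carried (shortJobs mL p) p s t).card ≤ M - mL := by
        refine card_carried_le h.inj fun j hj hjt => ?_
        have h2 := h.overtake l hl j hj (hjt.trans ht)
        have h3 := h.free j
        rw [card_carried_univ mL] at h3
        omega
      rw [card_carried_univ mL] at hf
      omega
    · exact Or.inr hf.2

/-- If `f` loses at most `r - i` against `c` at each `i < r`, it loses `r (r + 1) / 2` in all. -/
lemma two_mul_le_sum_of_le_add {c r : ℕ} {f : ℕ → ℕ} (h : ∀ i < r, c ≤ f i + (r - i)) :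
    2 * c * r ≤ 2 * ∑ i ∈ range r, f i + r * (r + 1) := by
  induction r generalizing f with
  | zero => simp
  | succ r ih =>
    have h1 := ih (f := fun i => f (i + 1)) fun i hi => by
      have := h (i + 1) (by omega)
      omega
    have h2 := h 0 (by omega)
    rw [sum_range_succ']
    simp only [Nat.sub_zero] at h2
    nlinarith

/-- Let the jobs of `J`, of length at least `c`, be list scheduled on `c` machines with at most one
start per slot. Then the machine time lost before slot `N` is at most `c / 2` per start.

A maximal run of slots with fewer than `c` busy machines starts a job in each of its slots, so it
is shorter than `c`. Going back in time from its end, where `c` machines are busy, each slot loses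
at most one more machine; so a run of length `r` loses at most `r (r + 1) / 2 ≤ c r / 2`. The jobs
started in a run that is cut off at `N` count with their full lengths, hence lose nothing. -/
lemma two_mul_le_of_greedy {J : Finset (Fin n)} {p s : Fin n → ℕ} (hs : Function.Injective s)
    {c N : ℕ} (hc : 0 < c) (hp : ∀ j ∈ J, c ≤ p j)
    (h : ∀ t < N, (∃ j ∈ J, s j = t) ∨ c ≤ (carried J p s t).card) :
    2 * c * N ≤ 2 * ∑ j ∈ J, p j + c * (startedBefore J s N).card := by
  -- `[b, t)` is the current run; everything before `b` is accounted for.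
  have key : ∀ t ≤ N, ∃ b ≤ t, t - b < c ∧ (∀ t', b ≤ t' → t' < t → ∃ j ∈ J, s j = t') ∧
      2 * c * b ≤ 2 * ∑ t' ∈ range b, (busy J p s t').card + c * (startedBefore J s b).card := by
    intro t
    induction t with
    | zero => exact fun _ => ⟨0, by simp [hc]⟩
    | succ t ih =>
      intro ht
      obtain ⟨b, hbt, hrc, hrun, hb⟩ := ih (by omega)
      by_cases hfull : c ≤ (busy J p s t).card
      · refine ⟨t + 1, le_rfl, by omega, fun t' h1 h2 => by omega, ?_⟩
        obtain ⟨r, rfl⟩ := Nat.exists_eq_add_of_le hbt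
        have hloss : ∀ i < r, c ≤ (busy J p s (b + i)).card + (r - i) := by
          intro i hi
          have hsub : busy J p s (b + r) ⊆ busy J p s (b + i) ∪
              J.filter fun j => s j ∈ Ioc (b + i) (b + r) := by
            intro j hj
            obtain ⟨h1, h2, h3⟩ := mem_filter.mp hj
            rw [mem_union, busy, mem_filter, mem_filter, mem_Ioc]
            by_cases h4 : s j ≤ b + i
            · exact Or.inl ⟨h1, h4, by omega⟩
            · exact Or.inr ⟨h1, by omega, h2⟩
          have h1 : (J.filter fun j => s j ∈ Ioc (b + i) (b + r)).card ≤ r - i := by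
            calc _ ≤ (Ioc (b + i) (b + r)).card :=
                  card_le_card_of_injOn s (fun j hj => (mem_filter.mp hj).2) hs.injOn
              _ = r - i := by rw [Nat.card_Ioc]; omega
          have h2 := (card_le_card hsub).trans (card_union_le _ _)
          omega
        have h1 := two_mul_le_sum_of_le_add hloss
        have h2 : r ≤ (J.filter fun j => b ≤ s j ∧ s j < b + r + 1).card := by
          have := sub_le_card_starts hrun
          have h3 : (J.filter fun j => b ≤ s j ∧ s j < b + r) ⊆
              J.filter fun j => b ≤ s j ∧ s j < b + r + 1 := by
            intro j
            simp only [mem_filter]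
            exact fun h => ⟨h.1, h.2.1, by omega⟩
          have := card_le_card h3
          omega
        rw [card_startedBefore_split J (show b ≤ b + r + 1 by omega), sum_range_succ,
          sum_range_add]
        have h3 : r * (r + 1) ≤ c * r := by
          rw [mul_comm]
          exact Nat.mul_le_mul_right r (by omega)
        have h4 := Nat.mul_le_mul_left c h2
        nlinarith
      · have hstart : ∃ j ∈ J, s j = t := by
          rcases h t (by omega) with h1 | h1
          · exact h1
          · exact absurd (h1.trans (card_le_card (carried_subset_busy _ _ _ _))) hfull
        have hrun' : ∀ t', b ≤ t' → t' < t + 1 → ∃ j ∈ J, s j = t' := by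
          intro t' h1 h2
          rcases (Nat.lt_succ_iff_lt_or_eq.mp h2) with h3 | rfl
          · exact hrun t' h1 h3
          · exact hstart
        refine ⟨b, by omega, ?_, hrun', hb⟩
        -- A run of length `c` would leave all the jobs started in it running.
        by_contra hlong
        have h1 := sub_le_card_starts hrun'
        have h2 : (J.filter fun j => b ≤ s j ∧ s j < t + 1) ⊆ busy J p s t := by
          intro j hj
          obtain ⟨h3, h4, h5⟩ := mem_filter.mp hj
          have := hp j h3
          exact mem_filter.mpr ⟨h3, by omega, by omega⟩
        have := card_le_card h2
        omega
  obtain ⟨b, hbN, -, hrun, hb⟩ := key N le_rfl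
  have h1 := sub_le_card_starts hrun
  set R := J.filter fun j => b ≤ s j ∧ s j < N with hR
  have h2 : ∑ t' ∈ range b, (busy J p s t').card ≤ ∑ j ∈ startedBefore J s b, p j := by
    refine le_trans (sum_le_sum fun t' ht' => card_le_card ?_)
      (sum_card_busy_le (startedBefore J s b) p s (range b))
    intro j hj
    obtain ⟨h3, h4, h5⟩ := mem_filter.mp hj
    rw [mem_range] at ht'
    exact mem_filter.mpr ⟨mem_filter.mpr ⟨h3, by omega⟩, h4, h5⟩
  have h3 : (N - b) * c ≤ ∑ j ∈ R, p j := by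
    refine (Nat.mul_le_mul_right c h1).trans ?_
    rw [← smul_eq_mul]
    exact card_nsmul_le_sum _ _ _ fun j hj => hp j (mem_filter.mp hj).1
  have h4 : ∑ j ∈ startedBefore J s b, p j + ∑ j ∈ R, p j ≤ ∑ j ∈ J, p j := by
    rw [← sum_union]
    · exact sum_le_sum_of_subset (union_subset (filter_subset _ _) (filter_subset _ _))
    · rw [disjoint_left]
      intro j
      simp only [startedBefore, hR, mem_filter]
      omega
  have h5 := Nat.mul_le_mul_left c
    ((Nat.le_add_right _ _).trans (card_startedBefore_split (s := s) J hbN).ge)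
  obtain ⟨r, rfl⟩ := Nat.exists_eq_add_of_le hbN
  rw [Nat.add_sub_cancel_left] at h3
  nlinarith

/-- The long jobs up to `l`, with `l` included, are at least as long as `l`. -/
lemma IsMixing.card_insert_long {M mL : ℕ} {p s : Fin n → ℕ} (h : IsMixing M mL p s) {l : Fin n}
    (hl : l ∈ longJobs mL p) :
    (insert l (startedBefore (longJobs mL p) s (s l))).card =
        (startedBefore (longJobs mL p) s (s l)).card + 1 ∧
      ∀ j ∈ insert l (startedBefore (longJobs mL p) s (s l)), p l ≤ p j := by
  refine ⟨card_insert_of_notMem (by simp [startedBefore]), fun j hj => ?_⟩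
  rcases mem_insert.mp hj with rfl | hj
  · exact le_rfl
  · exact h.long_order l hl j (mem_filter.mp hj).1 (mem_filter.mp hj).2

lemma IsMixing.card_long_add_le {m M mL : ℕ} {p s s' : Fin n → ℕ} (h : IsMixing M mL p s)
    (h' : Feasible m 1 p s') {l : Fin n} (hl : l ∈ longJobs mL p) :
    (startedBefore (longJobs mL p) s (s l)).card + p l ≤ makespan p s' :=
  h'.card_add_le (h.card_insert_long hl).1.ge (h.card_insert_long hl).2

lemma IsMixing.card_long_lt {m M mL : ℕ} {p s s' : Fin n → ℕ} (h : IsMixing M mL p s)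
    (h' : Feasible m 1 p s') {l : Fin n} (hl : l ∈ longJobs mL p)
    (hhalf : makespan p s' < 2 * p l) :
    (startedBefore (longJobs mL p) s (s l)).card < m := by
  have := h'.card_le_of_half (S := insert l (startedBefore (longJobs mL p) s (s l)))
    fun j hj => by have := (h.card_insert_long hl).2 j hj; omega
  rw [(h.card_insert_long hl).1] at this
  omega

lemma IsMixing.exists_long_start {M mL : ℕ} {p s : Fin n → ℕ} (h : IsMixing M mL p s)
    (hmL : mL ≤ M) {l : Fin n} (hl : l ∈ longJobs mL p) {t : ℕ} (ht : t < s l)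
    (hlt : (carried (longJobs mL p) p s t).card < mL) : ∃ j ∈ longJobs mL p, s j = t :=
  (h.long_greedy hmL hl ht).resolve_right (by omega)

lemma card_carried_le_startedBefore (J : Finset (Fin n)) (p s : Fin n → ℕ) (t : ℕ) :
    (carried J p s t).card ≤ (startedBefore J s t).card :=
  card_le_card fun _ hj => mem_filter.mpr ⟨(mem_filter.mp hj).1, (mem_filter.mp hj).2.1⟩

/-- A long job preceded by fewer than `mL` long jobs starts without delay. -/
lemma IsMixing.start_le_of_card_lt {M mL : ℕ} {p s : Fin n → ℕ} (h : IsMixing M mL p s)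
    (hmL : mL ≤ M) {l : Fin n} (hl : l ∈ longJobs mL p)
    (hK : (startedBefore (longJobs mL p) s (s l)).card < mL) :
    s l ≤ (startedBefore (longJobs mL p) s (s l)).card := by
  have h1 := sub_le_card_starts (s := s) (J := longJobs mL p) (a := 0) (b := s l) fun t _ ht =>
    h.exists_long_start hmL hl ht <| by
      have h2 := card_carried_le_startedBefore (longJobs mL p) p s t
      have h3 := card_startedBefore_split (s := s) (longJobs mL p) ht.le
      omega
  simpa [startedBefore] using h1

/-- The first `mL` long jobs end no later than the makespan `D` of any schedule. From slot `D` on,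
only the few other long jobs that precede `l` can be running, so a long job starts in each slot. -/
lemma IsMixing.start_add_le {m M mL : ℕ} {p s s' : Fin n → ℕ} (h : IsMixing M mL p s)
    (h' : Feasible m 1 p s') (hmL : mL ≤ M) (hm : m ≤ 2 * mL) {l : Fin n}
    (hl : l ∈ longJobs mL p) (hK : mL ≤ (startedBefore (longJobs mL p) s (s l)).card)
    (hhalf : makespan p s' < 2 * p l) :
    s l + mL ≤ makespan p s' + (startedBefore (longJobs mL p) s (s l)).card := by
  set D := makespan p s' with hD
  set K := (startedBefore (longJobs mL p) s (s l)).card with hKdef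
  have hKs : K ≤ s l := card_startedBefore_le h.inj (longJobs mL p) (s l)
  have hKm : K < m := h.card_long_lt h' hl hhalf
  have hKD : K + p l ≤ D := h.card_long_add_le h' hl
  have hfirst : ∀ t < mL, ∃ j ∈ longJobs mL p, s j = t := fun t ht =>
    h.exists_long_start hmL hl (by omega) <| by
      have h2 := card_carried_le_startedBefore (longJobs mL p) p s t
      have h3 := card_startedBefore_le h.inj (longJobs mL p) t
      omega
  have hstarted : ∀ t ≤ mL, t ≤ (startedBefore (longJobs mL p) s t).card := fun t ht => by
    have := sub_le_card_starts (s := s) (J := longJobs mL p) (a := 0) (b := t) fun t' _ h1 =>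
      hfirst t' (by omega)
    simpa [startedBefore] using this
  have hend : ∀ j ∈ longJobs mL p, s j < mL → s j + p j ≤ D := fun j hj hjm => by
    have h1 := (h.card_insert_long hj).1
    have h2 := hstarted (s j) hjm.le
    exact h'.card_add_le (by omega) (h.card_insert_long hj).2
  rcases le_or_gt (s l) D with hle | hgt
  · omega
  have hlate : ∀ t, D ≤ t → t < s l → ∃ j ∈ longJobs mL p, s j = t := fun t hDt ht =>
    h.exists_long_start hmL hl ht <| by
      have h1 := card_startedBefore_split (s := s) (longJobs mL p) (show mL ≤ s l by omega)
      have h2 := hstarted mL le_rfl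
      have h3 : carried (longJobs mL p) p s t ⊆
          (longJobs mL p).filter fun j => mL ≤ s j ∧ s j < s l := by
        intro j hj
        obtain ⟨h4, h5, h6⟩ := mem_filter.mp hj
        refine mem_filter.mpr ⟨h4, ?_, by omega⟩
        by_contra h7
        have := hend j h4 (by omega)
        omega
      have h4 := card_le_card h3
      omega
  have h1 := card_startedBefore_split (s := s) (longJobs mL p) (show mL ≤ s l by omega)
  have h2 := hstarted mL le_rfl
  have h3 := sub_le_card_starts hlate
  have h4 : ((longJobs mL p).filter fun j => D ≤ s j ∧ s j < s l) ⊆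
      (longJobs mL p).filter fun j => mL ≤ s j ∧ s j < s l := by
    intro j
    simp only [mem_filter]
    exact fun h => ⟨h.1, by omega, h.2.2⟩
  have h5 := card_le_card h4
  omega

/-- The bound `s l ≤ (m / mL) D + K / 2`, where `D` is the makespan of any schedule on `m` machines
and `K` long jobs precede `l`. -/
lemma IsMixing.two_mul_start_le {m M mL : ℕ} {p s s' : Fin n → ℕ} (h : IsMixing M mL p s)
    (h' : Feasible m 1 p s') (hpos : 0 < mL) (hmL : mL ≤ M) {l : Fin n}
    (hl : l ∈ longJobs mL p) :
    2 * mL * s l ≤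
      2 * (m * makespan p s') + mL * (startedBefore (longJobs mL p) s (s l)).card := by
  have h1 := two_mul_le_of_greedy h.inj hpos (J := longJobs mL p)
    (fun j hj => (mem_filter.mp hj).2) fun t ht => h.long_greedy hmL hl ht
  have h2 : ∑ j ∈ longJobs mL p, p j ≤ ∑ j, p j := sum_le_sum_of_subset (subset_univ _)
  have h3 := h'.sum_le
  omega

/-! ### The approximation ratio -/

lemma le_reserved (M : ℕ) : 5 * M ≤ 6 * reserved M := by
  have h : ((5 * M : ℕ) : ℚ) / 6 ≤ reserved M := by push_cast; exact Nat.le_ceil _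
  rw [div_le_iff₀ (by norm_num)] at h
  have : ((5 * M : ℕ) : ℚ) ≤ ((6 * reserved M : ℕ) : ℚ) := by push_cast at h ⊢; linarith
  exact_mod_cast this

lemma reserved_lt (M : ℕ) : 6 * reserved M < 5 * M + 6 := by
  have h : (reserved M : ℚ) < 5 * M / 6 + 1 := Nat.ceil_lt_add_one (by positivity)
  have : ((6 * reserved M : ℕ) : ℚ) < ((5 * M + 6 : ℕ) : ℚ) := by push_cast; linarith
  exact_mod_cast this

lemma lsmApprox_of_completion_le {ρ : ℝ} (hρ : 0 ≤ ρ) {m M : ℕ} (hM : 0 < M) {p : Fin n → ℕ}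
    (hp : ∀ j, 0 < p j)
    (h : ∀ s s' : Fin n → ℕ, IsMixing M (reserved M) p s → Feasible m 1 p s' →
      ∀ l, (s l : ℝ) + p l ≤ ρ * makespan p s') : LSMApprox ρ m M p := by
  have hmL : 0 < reserved M := by have := le_reserved M; omega
  choose s hs using fun j => Option.ne_none_iff_exists'.mp (lsmRun_complete hM hmL hp j)
  have hmix := isMixing_of_lsmRun hs
  refine ⟨s, hs, hmix.feasible hM, fun s' hs' => ?_⟩
  have h0 : 0 ≤ ρ * makespan p s' := by positivity
  refine le_trans (Nat.cast_le.mpr (Finset.sup_le fun l _ => Nat.le_floor ?_)) (Nat.floor_le h0)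
  push_cast
  exact h s s' hmix hs' l

/-- On `M ≥ 6m/5` machines, at least `m` machines are reserved for long jobs. -/
theorem lsmApprox_of_augmentation {m M : ℕ} (hm : 0 < m) (hmM : 6 * m ≤ 5 * M) {p : Fin n → ℕ}
    (hp : ∀ j, 0 < p j) : LSMApprox 1.985 m M p := by
  refine lsmApprox_of_completion_le (by norm_num) (by omega) hp fun s s' hs hs' l => ?_
  have hr := le_reserved M
  have hr' := reserved_lt M
  set mL := reserved M
  set D := makespan p s'
  have hD : (0 : ℝ) ≤ D := by positivity
  by_cases hl : mL ≤ p l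
  · have hl : l ∈ longJobs mL p := mem_filter.mpr ⟨mem_univ _, hl⟩
    have h1 := hs.card_long_add_le hs' hl
    rcases le_or_gt (2 * p l) D with hhalf | hhalf
    · have h2 := hs.two_mul_start_le hs' (by omega) (by omega) hl
      have h3 := Nat.mul_le_mul_right D (show m ≤ mL by omega)
      have h4 : 2 * s l ≤ 2 * D + (startedBefore (longJobs mL p) s (s l)).card := by
        refine Nat.le_of_mul_le_mul_left (c := mL) ?_ (by omega)
        change m * D ≤ mL * D at h3
        change 2 * mL * s l ≤ 2 * (m * D) + _ at h2
        nlinarith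
      have h5 : 4 * (s l + p l) ≤ 7 * D := by
        change _ ≤ D at h1
        omega
      have h6 : (4 : ℝ) * (s l + p l) ≤ 7 * D := by exact_mod_cast h5
      linarith
    · have h2 := hs.card_long_lt hs' hl hhalf
      have h3 := hs.start_le_of_card_lt (by omega) hl (by omega)
      have h4 : s l + p l ≤ D := by omega
      have h5 : (s l : ℝ) + p l ≤ D := by exact_mod_cast h4
      linarith
  · have hl : l ∈ shortJobs mL p := mem_filter.mpr ⟨mem_univ _, by omega⟩
    have h1 := hs.short_completion_le hs' hl
    have h2 := (card_fullSlots_mul_le M p s (s l)).trans hs'.sum_le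
    set F := (fullSlots M p s (s l)).card
    have h3 : 6 * F ≤ 5 * D := by
      refine Nat.le_of_mul_le_mul_left (c := m) ?_ hm
      change F * M ≤ m * D at h2
      have := Nat.mul_le_mul_left F hmM
      nlinarith
    have h4 : (s l : ℝ) + p l ≤ D + F := by exact_mod_cast h1
    have h5 : (6 : ℝ) * F ≤ 5 * D := by exact_mod_cast h3
    linarith

/-- Without extra machines, few jobs of near-maximal length are allowed; `m` is large so that the
rounding in `mL ≈ 5 m / 6` and the shift by one in `lengthBound ≤ D + 1` are absorbed. -/
theorem lsmApprox_of_card_nearMaximal_le {m : ℕ} (hm : 1000 ≤ m) {p : Fin n → ℕ}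
    (hp : ∀ j, 0 < p j) (hnear : (nearMaximal (1 / 50) m p).card ≤ reserved m) :
    LSMApprox 1.985 m m p := by
  refine lsmApprox_of_completion_le (by norm_num) (by omega) hp fun s s' hs hs' l => ?_
  have hr := le_reserved m
  have hr' := reserved_lt m
  set mL := reserved m
  have hbound := hs'.lengthBound_le (by omega)
  set D := makespan p s' with hDdef
  have hD : (0 : ℝ) ≤ D := by positivity
  by_cases hl : mL ≤ p l
  · have hl : l ∈ longJobs mL p := mem_filter.mpr ⟨mem_univ _, hl⟩
    have h1 := hs.card_long_add_le hs' hl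
    rcases le_or_gt (2 * p l) D with hhalf | hhalf
    · have h2 := hs.two_mul_start_le hs' (by omega) (by omega) hl
      rw [← hDdef] at h1 h2
      have h4 : 10 * s l ≤ 12 * D + 5 * (startedBefore (longJobs mL p) s (s l)).card := by
        refine Nat.le_of_mul_le_mul_left (c := mL) ?_ (by omega)
        have h3 := Nat.mul_le_mul_right D hr
        nlinarith
      have h5 : 20 * (s l + p l) ≤ 39 * D := by omega
      have h6 : (20 : ℝ) * (s l + p l) ≤ 39 * D := by exact_mod_cast h5
      linarith
    · set K := (startedBefore (longJobs mL p) s (s l)).card with hK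
      rcases lt_or_ge K mL with hlt | hge
      · have h3 := hs.start_le_of_card_lt (by omega) hl hlt
        have h4 : s l + p l ≤ D := by omega
        have h5 : (s l : ℝ) + p l ≤ D := by exact_mod_cast h4
        linarith
      · have h2 := hs.card_long_lt hs' hl hhalf
        have h3 := hs.start_add_le hs' (by omega) (by omega) hl hge hhalf
        -- More than `mL` jobs are at least as long as `l`, so `l` is not of near-maximal length.
        have h4 : (p l : ℝ) ≤ (1 - 1 / 50) * lengthBound m p := by
          by_contra! hnot
          have h5 : insert l (startedBefore (longJobs mL p) s (s l)) ⊆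
              nearMaximal (1 / 50) m p := fun j hj =>
            mem_filter.mpr ⟨mem_univ _, hnot.trans_le
              (by exact_mod_cast (hs.card_insert_long hl).2 j hj)⟩
          have h6 := card_le_card h5
          rw [(hs.card_insert_long hl).1] at h6
          omega
        have h5 : s l + mL ≤ D + K := h3
        have h6 : 5 * K < 6 * mL := by omega
        have h7 : 800 ≤ mL := by omega
        have h5 : (s l : ℝ) + mL ≤ D + K := by exact_mod_cast h5
        have h6 : (5 : ℝ) * K < 6 * mL := by exact_mod_cast h6
        have h7 : (800 : ℝ) ≤ mL := by exact_mod_cast h7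
        have h1 : (K : ℝ) + p l ≤ D := by exact_mod_cast h1
        -- Either `2 D - mL` or `D + mL / 5 + (49 / 50) (D + 1)` bounds the completion time well.
        rcases le_or_gt (0.015 * (D : ℝ)) mL with hc | hc <;> linarith
  · have hl : l ∈ shortJobs mL p := mem_filter.mpr ⟨mem_univ _, by omega⟩
    have h1 := hs.short_completion_le hs' hl
    obtain ⟨A, hA1, hA2⟩ := hs.exists_short_starts (by omega) (s l)
    replace hA2 := hA2.trans hs'.sum_le
    rw [← hDdef] at h1 hA2
    set F := (fullSlots m p s (s l)).card
    obtain ⟨q, hq⟩ := Nat.exists_eq_add_of_le (show mL ≤ m by omega)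
    have hq' : m - mL = q := by omega
    rw [hq'] at hA1 hA2
    -- `q ≥ m / 6 - 1` and `mL < 5 m / 6 + 1`; rounding costs at most `m / 600`, as `m ≥ 1000`.
    have hq1 : 33 * m ≤ 200 * q := by omega
    have hq2 : 200 * mL ≤ 167 * m := by omega
    have hFA : 33 * F ≤ 167 * A := by
      refine Nat.le_of_mul_le_mul_right (c := m) ?_ (by omega)
      have := Nat.mul_le_mul_left F hq1
      have := Nat.mul_le_mul_left A hq2
      nlinarith
    have hFD : 200 * F + 33 * A ≤ 200 * D := by
      refine Nat.le_of_mul_le_mul_right (c := m) ?_ (by omega)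
      have := Nat.mul_le_mul_left A hq1
      nlinarith
    have h3 : 200 * F ≤ 197 * D := by omega
    have h4 : (s l : ℝ) + p l ≤ D + F := by exact_mod_cast h1
    have h5 : (200 : ℝ) * F ≤ 197 * D := by exact_mod_cast h3
    linarith

end BJSP

theorem mainTheorem4 :
    (∃ ε : ℝ, 0 < ε ∧ ε ≤ 1 / 50 ∧ ∃ m₀ : ℕ, ∀ m : ℕ, m₀ ≤ m →
      ∀ (n : ℕ) (p : Fin n → ℕ), (∀ j, 0 < p j) →
        (BJSP.nearMaximal ε m p).card ≤ ⌈(5 * m / 6 : ℚ)⌉₊ →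
          BJSP.LSMApprox 1.985 m m p) ∧
    (∃ m₀ : ℕ, ∀ m : ℕ, m₀ ≤ m →
      ∀ (n : ℕ) (p : Fin n → ℕ), (∀ j, 0 < p j) →
        BJSP.LSMApprox 1.985 m ⌈(6 * m / 5 : ℚ)⌉₊ p) := by
  refine ⟨⟨1 / 50, by norm_num, le_rfl, 1000, fun m hm n p hp hnear =>
    BJSP.lsmApprox_of_card_nearMaximal_le hm hp hnear⟩, 1, fun m hm n p hp =>
    BJSP.lsmApprox_of_augmentation hm ?_ hp⟩
  have h : ((6 * m : ℕ) : ℚ) / 5 ≤ (⌈(6 * m / 5 : ℚ)⌉₊ : ℚ) := by push_cast; exact Nat.le_ceil _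
  rw [div_le_iff₀ (by norm_num), mul_comm _ (5 : ℚ)] at h
  exact_mod_cast h
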